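/- Let $G$ be a finite abelian group. For $T\subseteq G$ let $\Sigma(T)=\{\sum_{x\in X}x : X\subseteq T\}$ denote the set of subset sums of $T$ (the empty sum $0$ included), let $-T=\{-x : x\in T\}$, and let $\langle T\rangle$ be the subgroup generated by $T$. Let $S\subseteq G$ be a subset that generates $G$, with $S\cap(-S)=\emptyset$ and $|S|\geqslant 4$, and put $\hat S=S\cup\{0\}\cup(-S)$. Suppose that $\hat S$ has an AP-representation, that is, there is a subgroup $H$ of $G$ such that $$|\hat S+H|<\min\bigl(|G|,\ |H|+|\hat S|\bigr)$$ and such that the image of $\hat S$ under the canonical homomorphism $G\to G/H$ is an arithmetic progression, i.e. a set of the form $\{a,a+d,\dots,a+(n-1)d\}$ with $a,d\in G/H$ and $n\geqslant 1$. Then at least one of the following holds. (i) $\displaystyle |\Sigma(S)|\geqslant \frac{|S|(|S|+1)}{2}+1$. (ii) There is a non-empty subset $S'\subseteq S$ with $\displaystyle |\Sigma(S')|>\frac{|\langle S'\rangle|}{2}$. -/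

import Mathlib

open scoped Pointwise

namespace APRep

/-- `Ŝ = S ∪ {0} ∪ (-S)`. -/
def hat {G : Type*} [AddCommGroup G] [DecidableEq G] (S : Finset G) : Finset G :=
  S ∪ {0} ∪ (-S)

/-- `X` is an arithmetic progression `{a, a + d, …, a + (n - 1) d}` with `n ≥ 1` terms
(as a set: terms may coincide). -/
def IsArithProg {Q : Type*} [AddCommGroup Q] (X : Set Q) : Prop :=
  ∃ (a d : Q) (n : ℕ), 0 < n ∧ X = {x | ∃ i : ℕ, i < n ∧ x = a + i • d}

/-- `A` has an AP-representation modulo `H`: `|A + H| < min(|G|, |H| + |A|)` and the image of `A`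
in `G / H` is an arithmetic progression. -/
structure IsAPRepModulo {G : Type*} [AddCommGroup G] (A : Finset G) (H : AddSubgroup G) :
    Prop where
  card_lt : ((A : Set G) + (H : Set G)).ncard < min (Nat.card G) (Nat.card H + A.card)
  arithProg : IsArithProg ((fun x : G => (x : G ⧸ H)) '' (A : Set G))

/-- `A` has an AP-representation, i.e. it has one modulo some subgroup of `G`. -/
def HasAPRepresentation {G : Type*} [AddCommGroup G] (A : Finset G) : Prop :=
  ∃ H : AddSubgroup G, IsAPRepModulo A H

end APRep

/-! Suppose (ii) fails, so every non-empty `S' ⊆ S` satisfies `2|Σ(S')| ≤ |⟨S'⟩|`. Since `Ŝ` is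
symmetric, contains `0` and does not fill `G/H`, its image there is a proper progression `-m•g, …,
m•g` in a cyclic group of order `q > 2m + 1`, and the bound on `|Ŝ + H|` gives `m|H| ≤ |S|`
(`exists_levels_of_isAPRepModulo`). Changing signs of elements only translates the set of subset
sums, so `S` may be replaced by a set `T` whose elements lie in the cosets `j•g + H` with level `j`
in `0, …, m`.

Let `h = |H|`, let `Z` be the level-zero part, `k = |Z|`, and `|T| = mh + t`. Then `t ≤ k`, and each
positive level has at least `h + t - k` elements. A growth argument
(`two_mul_card_le_card_subsetSum`) gives `|Σ(Z)| ≥ 2k`, and the failure of (ii) for `Z` gives `4k ≤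
h`. Thus `Σ(Z)` makes up for the elements missing from a positive level, and pigeonhole in cosets
fills whole cosets with subset sums.

Let `L` be the sum of all levels. For `m ≥ 2` all cosets `1, …, L - 1` are full; for `m = 1` those
near the ends are full, and the middle ones are bounded below by sums of `r` distinct elements. If
the levels wrapped around modulo `q`, `Σ(T)` would exceed half of `G`; otherwise the cosets are
disjoint, and adding up their contributions gives the quadratic bound
(`card_subsetSum_ge_of_levels`). -/

set_option linter.unusedSectionVars false

/-! ### Translations that change a set in exactly one element. -/

section Swap

variable {G : Type*} [AddCommGroup G]

/-- `B + x` arises from `B` by replacing the element `a` by the new element `p`. -/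
structure IsSwap (B : Finset G) (x p a : G) : Prop where
  p_notMem : p ∉ B
  a_mem : a ∈ B
  mem_iff : ∀ z, z - x ∈ B ↔ (z ∈ B ∧ z ≠ a) ∨ z = p

lemma IsSwap.add_mem {B : Finset G} {x p a z : G} (h : IsSwap B x p a) (hz : z ∈ B) :
    z + x ∈ B ∨ z + x = p := by
  have := (h.mem_iff (z + x)).1 (by simpa using hz)
  tauto

/-- Two swaps with the same new element. -/
lemma IsSwap.eq_add_of_eq {B : Finset G} {x y p a a' : G} (h : IsSwap B x p a)
    (h' : IsSwap B y p a') (hy : y ≠ 0) (hxy : x ≠ y) : a' = p + y := by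
  have h1 : p - x ∈ B := (h.mem_iff p).2 (Or.inr rfl)
  have h2 : p - x + y ∈ B := by
    rcases h'.add_mem h1 with h2 | h2
    · exact h2
    · exact absurd (by rw [sub_add_eq_add_sub, sub_eq_iff_eq_add] at h2; exact (add_left_cancel h2).symm) hxy
  have h3 : p + y ∈ B := by
    rcases h.add_mem h2 with h3 | h3
    · convert h3 using 1; abel
    · have h4 : p - x + y + x = p + y := by abel
      rw [h4] at h3
      exact absurd (by simpa using h3) hy
  by_contra hne
  have := (h'.mem_iff (p + y)).2 (Or.inl ⟨h3, fun h => hne h.symm⟩)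
  exact h.p_notMem (by simpa using this)

/-- Two swaps with different new elements. -/
lemma IsSwap.eq_add_of_ne {B : Finset G} {x y p p' a a' : G} (h : IsSwap B x p a)
    (h' : IsSwap B y p' a') (hx : x ≠ 0) (hp : p' ≠ p) : p' = a + y := by
  by_contra hne
  have h1 : p' - x ∉ B := by
    intro hm
    rcases (h.mem_iff p').1 hm with h2 | h2
    · exact h'.p_notMem h2.1
    · exact hp h2
  have h2 : p' - y ∈ B := (h'.mem_iff p').2 (Or.inr rfl)
  have h3 : p' - y - x ∈ B :=
    (h.mem_iff (p' - y)).2 (Or.inl ⟨h2, fun h => hne (by rw [← h]; abel)⟩)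
  rcases h'.add_mem h3 with h4 | h4
  · exact h1 (by convert h4 using 1; abel)
  · have h5 : p' - y - x + y = p' - x := by abel
    rw [h5] at h4
    exact hx (by simpa using h4)

/-- If `a ≠ a'`, then `a` survives translation by `y`, so `a - y` and then `a - y - x` lie in `B`.
Adding `y` back would put `a - x` in `B`, though `a` is lost under translation by `x`; the only
escape, `a - x = p' = a + y`, is excluded by `x + y ≠ 0`. -/
lemma IsSwap.old_eq_of_ne {B : Finset G} {x y p p' a a' : G} (h : IsSwap B x p a)
    (h' : IsSwap B y p' a') (hx : x ≠ 0) (hy : y ≠ 0) (hxy : x + y ≠ 0) (hp : p' ≠ p) :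
    a = a' := by
  by_contra hne
  have hp' := h.eq_add_of_ne h' hx hp
  have h1 : a - y ∈ B := (h'.mem_iff a).2 (Or.inl ⟨h.a_mem, hne⟩)
  have h2 : a - y - x ∈ B :=
    (h.mem_iff (a - y)).2 (Or.inl ⟨h1, fun h => hy (by simpa using h)⟩)
  have h3 : a - x ∉ B := by
    intro hm
    rcases (h.mem_iff a).1 hm with h4 | h4
    · exact h4.2 rfl
    · exact h.p_notMem (h4 ▸ h.a_mem)
  rcases h'.add_mem h2 with h4 | h4
  · exact h3 (by convert h4 using 1; abel)
  · refine hxy ?_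
    rw [hp', sub_add_eq_add_sub, sub_add_cancel, sub_eq_iff_eq_add] at h4
    have : a + 0 = a + (x + y) := by rw [add_zero]; nth_rewrite 1 [h4]; abel
    exact (add_left_cancel this).symm

end Swap

/-! ### Linear growth: `|Σ(T)| ≥ 2|T|` unless some subset already fills more than half of its span.
-/

section Growth

variable {G : Type*} [AddCommGroup G] [DecidableEq G]

lemma add_mem_subsetSum_union {A B : Finset G} (hAB : Disjoint A B) {x y : G}
    (hx : x ∈ A.subsetSum) (hy : y ∈ B.subsetSum) : x + y ∈ (A ∪ B).subsetSum := by
  obtain ⟨X, hX, rfl⟩ := Finset.mem_subsetSum_iff.1 hx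
  obtain ⟨Y, hY, rfl⟩ := Finset.mem_subsetSum_iff.1 hy
  refine Finset.mem_subsetSum_iff.2 ⟨X ∪ Y, Finset.union_subset_union hX hY, ?_⟩
  exact Finset.sum_union (Finset.disjoint_of_subset_left hX (Finset.disjoint_of_subset_right hY hAB))

lemma sum_sub_mem_subsetSum {A : Finset G} {x : G} (hx : x ∈ A.subsetSum) :
    (∑ a ∈ A, a) - x ∈ A.subsetSum := by
  obtain ⟨X, hX, rfl⟩ := Finset.mem_subsetSum_iff.1 hx
  refine Finset.mem_subsetSum_iff.2 ⟨A \ X, Finset.sdiff_subset, ?_⟩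
  rw [eq_sub_iff_add_eq, Finset.sum_sdiff hX]

lemma subsetSum_subset_subgroup {A : Finset G} {K : AddSubgroup G} (hA : ∀ x ∈ A, x ∈ K) {x : G}
    (hx : x ∈ A.subsetSum) : x ∈ K := by
  obtain ⟨X, hX, rfl⟩ := Finset.mem_subsetSum_iff.1 hx
  exact K.sum_mem fun x hx => hA x (hX hx)

lemma add_mem_subsetSum_of_erase {T : Finset G} {x b : G} (hx : x ∈ T)
    (hb : b ∈ (T.erase x).subsetSum) : b + x ∈ T.subsetSum := by
  have h := add_mem_subsetSum_union (A := T.erase x) (B := {x}) (by simp) hb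
    (Finset.subset_subsetSum (Finset.mem_singleton_self x))
  rwa [Finset.union_comm, ← Finset.insert_eq, Finset.insert_erase hx] at h

/-- Removing `x` from `T` loses at least `|(Σ(T) + x) \ Σ(T)|` subset sums. -/
lemma card_subsetSum_erase_add_le {T : Finset G} {x : G} (hx : x ∈ T) :
    (T.erase x).subsetSum.card + (T.subsetSum.image (· + x) \ T.subsetSum).card
      ≤ T.subsetSum.card := by
  have hsub : (T.erase x).subsetSum ⊆ T.subsetSum :=
    Finset.subsetSum_mono (Finset.erase_subset _ _)
  have h : T.subsetSum.image (· + x) \ T.subsetSum ⊆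
      (T.subsetSum \ (T.erase x).subsetSum).image (· + x) := by
    intro y hy
    simp only [Finset.mem_sdiff, Finset.mem_image] at hy ⊢
    obtain ⟨⟨b, hb, rfl⟩, hy⟩ := hy
    exact ⟨b, ⟨hb, fun hb' => hy (add_mem_subsetSum_of_erase hx hb')⟩, rfl⟩
  have h1 := (Finset.card_le_card h).trans Finset.card_image_le
  rw [Finset.card_sdiff_of_subset hsub] at h1
  have := Finset.card_le_card hsub
  omega

/-- A nonempty finite subset of `⟨T⟩` stable under translations by `T` is everything. -/
lemma card_closure_le_of_stable {T X : Finset G} (hX : X.Nonempty)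
    (hXK : ∀ x ∈ X, x ∈ AddSubgroup.closure (T : Set G))
    (hst : ∀ y ∈ T, ∀ x ∈ X, x + y ∈ X) :
    Nat.card (AddSubgroup.closure (T : Set G)) ≤ X.card := by
  have hneg : ∀ y ∈ T, ∀ x ∈ X, x + -y ∈ X := by
    intro y hy x hx
    have himg : X.image (· + y) = X := by
      refine Finset.eq_of_subset_of_card_le ?_ ?_
      · intro z hz
        obtain ⟨b, hb, rfl⟩ := Finset.mem_image.1 hz
        exact hst y hy b hb
      · rw [Finset.card_image_of_injective _ (add_left_injective y)]
    rw [← himg] at hx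
    obtain ⟨b, hb, rfl⟩ := Finset.mem_image.1 hx
    simpa using hb
  have hall : ∀ z ∈ AddSubgroup.closure (T : Set G), ∀ x ∈ X, x + z ∈ X := by
    intro z hz
    induction hz using AddSubgroup.closure_induction'' with
    | zero => simp
    | mem y hy => exact hst y hy
    | neg_mem y hy => exact hneg y hy
    | add y z _ _ h1 h2 => intro x hx; rw [← add_assoc]; exact h2 _ (h1 _ hx)
  obtain ⟨x, hx⟩ := hX
  have hsub : (AddSubgroup.closure (T : Set G) : Set G) ⊆ X := by
    intro z hz
    have := hall (-x + z) (add_mem (neg_mem (hXK x hx)) hz) x hx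
    simpa using this
  have := Set.ncard_le_ncard hsub (Finset.finite_toSet X)
  rwa [Set.ncard_coe_finset] at this

lemma exists_isSwap {B : Finset G} {x : G} (h : (B.image (· + x) \ B).card = 1) :
    ∃ p a, IsSwap B x p a := by
  have hc : (B.image (· + x)).card = B.card :=
    Finset.card_image_of_injective _ (add_left_injective x)
  have h' : (B \ B.image (· + x)).card = 1 := by
    have := Finset.card_sdiff_add_card_inter B (B.image (· + x))
    have := Finset.card_sdiff_add_card_inter (B.image (· + x)) B
    rw [Finset.inter_comm] at this
    omega
  obtain ⟨p, hp⟩ := Finset.card_eq_one.1 h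
  obtain ⟨a, ha⟩ := Finset.card_eq_one.1 h'
  have him : ∀ z, z ∈ B.image (· + x) ↔ z - x ∈ B := by
    intro z
    simp [sub_eq_add_neg]
  have hp' : ∀ z, (z - x ∈ B ∧ z ∉ B) ↔ z = p := by
    intro z
    rw [← him, ← Finset.mem_sdiff, hp, Finset.mem_singleton]
  have ha' : ∀ z, (z ∈ B ∧ z - x ∉ B) ↔ z = a := by
    intro z
    rw [← him, ← Finset.mem_sdiff, ha, Finset.mem_singleton]
  refine ⟨p, a, ((hp' p).2 rfl).2, ((ha' a).2 rfl).1, fun z => ?_⟩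
  have h1 := hp' z
  have h2 := ha' z
  tauto

/-- If no translate by an element of `T` adds two elements to `B`, then `B` is more than half of
`⟨T⟩`. -/
lemma card_closure_lt_of_card_sdiff_le_one {T B : Finset G} (hT : ∀ x ∈ T, -x ∉ T)
    (hT2 : 2 ≤ T.card) (hB2 : 2 ≤ B.card)
    (hBK : ∀ x ∈ B, x ∈ AddSubgroup.closure (T : Set G))
    (hl : ∀ x ∈ T, (B.image (· + x) \ B).card ≤ 1) :
    Nat.card (AddSubgroup.closure (T : Set G)) < 2 * B.card := by
  have hT0 : ∀ x ∈ T, x ≠ 0 := by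
    rintro x hx rfl
    exact hT 0 hx (by simpa using hx)
  have hBne : B.Nonempty := Finset.card_pos.1 (by omega)
  by_cases h0 : ∃ x ∈ T, (B.image (· + x) \ B).card = 0
  · obtain ⟨x, hx, hx0⟩ := h0
    have hst : ∀ b ∈ B, b + x ∈ B := by
      intro b hb
      have := Finset.sdiff_eq_empty_iff_subset.1 (Finset.card_eq_zero.1 hx0)
      exact this (Finset.mem_image_of_mem _ hb)
    have hcl := card_closure_le_of_stable (T := T) hBne hBK ?_
    · omega
    intro y hy b hb
    -- Since `B + x = B`, a missing `b + y` forces `b + x + y` to be missing too: two distinct new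
    -- elements in `B + y`.
    by_contra hby
    have himg : B.image (· + x) = B :=
      Finset.eq_of_subset_of_card_le
        (fun z hz => by obtain ⟨c, hc, rfl⟩ := Finset.mem_image.1 hz; exact hst c hc)
        (by rw [Finset.card_image_of_injective _ (add_left_injective x)])
    have m1 : b + y ∈ B.image (· + y) \ B :=
      Finset.mem_sdiff.2 ⟨Finset.mem_image_of_mem _ hb, hby⟩
    have m2 : b + x + y ∈ B.image (· + y) \ B := by
      refine Finset.mem_sdiff.2 ⟨Finset.mem_image_of_mem _ (hst b hb), fun hm => hby ?_⟩
      rw [← himg] at hm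
      obtain ⟨c, hc, hcx⟩ := Finset.mem_image.1 hm
      have : c = b + y := by
        have : c + x = b + y + x := by rw [hcx]; abel
        exact add_right_cancel this
      exact this ▸ hc
    have := Finset.card_le_one.1 (hl y hy) _ m1 _ m2
    rw [add_right_comm] at this
    exact hT0 x hx (by simpa using this)
  · push Not at h0
    have hsw : ∀ x ∈ T, ∃ p a, IsSwap B x p a := fun x hx =>
      exists_isSwap (by have := h0 x hx; have := hl x hx; omega)
    choose! P A hPA using hsw
    obtain ⟨x, hx, y, hy, hxy⟩ := Finset.one_lt_card.1 hT2
    have hadd : ∀ u ∈ T, ∀ v ∈ T, u + v ≠ 0 := by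
      intro u hu v hv huv
      rw [add_eq_zero_iff_eq_neg] at huv
      exact hT v hv (huv ▸ hu)
    -- If the new elements are not all equal, all swaps lose the same element, and `B` without it is
    -- stable under `T`.
    by_cases hP : ∃ u ∈ T, ∃ v ∈ T, P u ≠ P v
    · obtain ⟨u, hu, v, hv, huv⟩ := hP
      have hne : ∀ z ∈ T, P z = A z + z ∧ A z = A u := by
        have key : ∀ z ∈ T, ∀ w ∈ T, P z ≠ P w → P z = A z + z ∧ A z = A w := by
          intro z hz w hw hzw
          have e1 := (hPA w hw).eq_add_of_ne (hPA z hz) (hT0 w hw) hzw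
          have e2 := (hPA w hw).old_eq_of_ne (hPA z hz) (hT0 w hw) (hT0 z hz)
            (hadd w hw z hz) hzw
          exact ⟨e2 ▸ e1, e2.symm⟩
        intro z hz
        have k1 := key u hu v hv huv
        by_cases hzu : P z = P u
        · have k2 := key z hz v hv (hzu ▸ huv)
          exact ⟨k2.1, k2.2.trans k1.2.symm⟩
        · exact key z hz u hu hzu
      have hcl := card_closure_le_of_stable (T := T) (X := B.erase (A u))
        (Finset.card_pos.1 (by rw [Finset.card_erase_of_mem (hPA u hu).a_mem]; omega))
        (fun z hz => hBK z (Finset.mem_of_mem_erase hz)) ?_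
      · rw [Finset.card_erase_of_mem (hPA u hu).a_mem] at hcl
        omega
      intro z hz b hb
      rw [Finset.mem_erase] at hb ⊢
      have hm := ((hPA z hz).mem_iff (b + z)).1 (by simpa using hb.2)
      rw [(hne z hz).1, (hne z hz).2, add_left_inj] at hm
      tauto
    -- With a common new element `P x`, each lost element is `P x + z`, so `B` together with `P x`
    -- is stable. Here `2 ≤ |B|` is needed for `|B| + 1 < 2|B|`.
    · push Not at hP
      have hA : ∀ z ∈ T, A z = P x + z := by
        intro z hz
        obtain ⟨w, hw, hwz⟩ : ∃ w ∈ T, w ≠ z := by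
          by_cases h : x = z
          · exact ⟨y, hy, fun h' => hxy (h.trans h'.symm)⟩
          · exact ⟨x, hx, h⟩
        have := (hPA w hw).eq_add_of_eq (hP z hz w hw ▸ hPA z hz) (hT0 z hz) hwz
        rw [this, hP w hw x hx]
      have hcl := card_closure_le_of_stable (T := T) (X := insert (P x) B)
        (Finset.insert_nonempty _ _) ?_ ?_
      · rw [Finset.card_insert_of_notMem (hPA x hx).p_notMem] at hcl
        omega
      · intro z hz
        rcases Finset.mem_insert.1 hz with rfl | hz
        · have := ((hPA x hx).mem_iff (P x)).2 (Or.inr rfl)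
          have := add_mem (hBK _ this) (AddSubgroup.subset_closure hx)
          simpa using this
        · exact hBK z hz
      · intro z hz b hb
        rw [Finset.mem_insert] at hb ⊢
        rcases hb with rfl | hb
        · right
          rw [← hA z hz]
          exact (hPA z hz).a_mem
        · have := (hPA z hz).add_mem hb
          rw [hP z hz x hx] at this
          tauto

/-- Induction on `|T|`: as `Σ(T)` is at most half of `⟨T⟩`, some `x ∈ T` moves at least two subset
sums out of `Σ(T)`, and deleting this `x` costs at least two sums. -/
theorem two_mul_card_le_card_subsetSum (T : Finset G) (hT : ∀ x ∈ T, -x ∉ T)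
    (hhalf : ∀ T' ⊆ T, T'.Nonempty →
      2 * T'.subsetSum.card ≤ Nat.card (AddSubgroup.closure (T' : Set G))) :
    2 * T.card ≤ T.subsetSum.card := by
  induction hn : T.card generalizing T with
  | zero => simp
  | succ n ih =>
    have hTne : T.Nonempty := Finset.card_pos.1 (by omega)
    have hT0 : ∀ x ∈ T, x ≠ 0 := by
      rintro x hx rfl
      exact hT 0 hx (by simpa using hx)
    have h2 : 2 ≤ T.subsetSum.card := by
      obtain ⟨x, hx⟩ := hTne
      exact Finset.one_lt_card.2 ⟨x, Finset.subset_subsetSum hx, 0, by simp, hT0 x hx⟩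
    rcases Nat.eq_zero_or_pos n with rfl | hn0
    · simpa using h2
    have : ∃ x ∈ T, 2 ≤ (T.subsetSum.image (· + x) \ T.subsetSum).card := by
      by_contra hcon
      push Not at hcon
      have := card_closure_lt_of_card_sdiff_le_one hT (by omega) h2
        (fun x hx => subsetSum_subset_subgroup
          (fun y hy => AddSubgroup.subset_closure hy) hx)
        (fun x hx => Nat.le_of_lt_succ (hcon x hx))
      have := hhalf T subset_rfl hTne
      omega
    obtain ⟨x, hx, hx2⟩ := this
    have h1 := card_subsetSum_erase_add_le hx
    have h3 := ih (T.erase x)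
      (fun y hy hy' => hT y (Finset.mem_of_mem_erase hy) (Finset.mem_of_mem_erase hy'))
      (fun T' hT' => hhalf T' (hT'.trans (Finset.erase_subset _ _)))
      (by rw [Finset.card_erase_of_mem hx, hn]; rfl)
    omega

end Growth

/-! ### Sums of a fixed number of distinct elements. -/

section RSum

variable {G : Type*} [AddCommGroup G] [DecidableEq G]

/-- Sums of `r` distinct elements of `A`. -/
def rSum (A : Finset G) (r : ℕ) : Finset G := (A.powersetCard r).image fun B => ∑ b ∈ B, b

lemma mem_rSum {A : Finset G} {r : ℕ} {x : G} :
    x ∈ rSum A r ↔ ∃ B ⊆ A, B.card = r ∧ ∑ b ∈ B, b = x := by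
  simp [rSum, Finset.mem_powersetCard, and_assoc]

lemma rSum_subset (A : Finset G) (r : ℕ) : rSum A r ⊆ A.subsetSum := by
  intro x hx
  obtain ⟨B, hB, -, rfl⟩ := mem_rSum.1 hx
  exact Finset.mem_subsetSum_iff.2 ⟨B, hB, rfl⟩

lemma rSum_nonempty {A : Finset G} {r : ℕ} (hr : r ≤ A.card) : (rSum A r).Nonempty :=
  (Finset.powersetCard_nonempty.2 hr).image _

/-- Fix `r` elements and let the last one vary over the rest of `A`. -/
lemma card_le_card_rSum_add {A : Finset G} {r : ℕ} (hr : r + 1 ≤ A.card) :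
    A.card ≤ (rSum A (r + 1)).card + r := by
  obtain ⟨Y, hY, hYc⟩ := Finset.exists_subset_card_eq (show r ≤ A.card by omega)
  have h : (A \ Y).image ((∑ y ∈ Y, y) + ·) ⊆ rSum A (r + 1) := by
    intro z hz
    obtain ⟨x, hx, rfl⟩ := Finset.mem_image.1 hz
    rw [Finset.mem_sdiff] at hx
    refine mem_rSum.2 ⟨insert x Y, Finset.insert_subset hx.1 hY, ?_, ?_⟩
    · rw [Finset.card_insert_of_notMem hx.2, hYc]
    · rw [Finset.sum_insert hx.2, add_comm]
  have h1 := Finset.card_le_card h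
  rw [Finset.card_image_of_injective _ (add_right_injective _), Finset.card_sdiff_of_subset hY] at h1
  omega

/-- Fix `r + 1` elements and omit one of them in all possible ways. -/
lemma lt_card_rSum {A : Finset G} {r : ℕ} (hr : r + 1 ≤ A.card) : r < (rSum A r).card := by
  obtain ⟨Y, hY, hYc⟩ := Finset.exists_subset_card_eq hr
  have h : Y.image ((∑ y ∈ Y, y) - ·) ⊆ rSum A r := by
    intro z hz
    obtain ⟨x, hx, rfl⟩ := Finset.mem_image.1 hz
    refine mem_rSum.2 ⟨Y.erase x, (Finset.erase_subset _ _).trans hY, ?_, ?_⟩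
    · rw [Finset.card_erase_of_mem hx, hYc]; rfl
    · rw [eq_sub_iff_add_eq, Finset.sum_erase_add _ _ hx]
  have h1 := Finset.card_le_card h
  rw [Finset.card_image_of_injective _ (sub_right_injective), hYc] at h1
  omega

lemma sum_sub_mem {H : AddSubgroup G} {g : G} {lev : G → ℕ} {X : Finset G}
    (h : ∀ x ∈ X, x - lev x • g ∈ H) : ∑ x ∈ X, x - (∑ x ∈ X, lev x) • g ∈ H := by
  rw [Finset.sum_smul, ← Finset.sum_sub_distrib]
  exact H.sum_mem h

lemma rSum_sub_mem {H : AddSubgroup G} {g : G} {j : ℕ} {A : Finset G} {r : ℕ}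
    (h : ∀ x ∈ A, x - j • g ∈ H) {x : G} (hx : x ∈ rSum A r) : x - (r * j) • g ∈ H := by
  obtain ⟨B, hB, rfl, rfl⟩ := mem_rSum.1 hx
  have := sum_sub_mem (lev := fun _ => j) (fun x hx => h x (hB hx))
  simpa using this

end RSum

/-! ### Filling cosets of `H` with subset sums. -/

section Slice

variable {G : Type*} [AddCommGroup G] [Fintype G] [DecidableEq G] {H : AddSubgroup G} {g : G}

open scoped Classical in
/-- The part of `X` in the coset `ℓ • g + H`. -/
noncomputable def slice (H : AddSubgroup G) (g : G) (X : Finset G) (l : ℕ) : Finset G :=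
  X.filter fun x => x - l • g ∈ H

lemma mem_slice {X : Finset G} {l : ℕ} {x : G} : x ∈ slice H g X l ↔ x ∈ X ∧ x - l • g ∈ H := by
  simp [slice]

lemma card_slice_univ (l : ℕ) : (slice H g Finset.univ l).card = Nat.card H := by
  rw [← Nat.card_eq_finsetCard]
  exact Nat.card_congr
    { toFun := fun x => ⟨x.1 - l • g, (mem_slice.1 x.2).2⟩
      invFun := fun u => ⟨u.1 + l • g, mem_slice.2 ⟨Finset.mem_univ _, by simp⟩⟩
      left_inv := fun x => by simp
      right_inv := fun u => by simp }

/-- All of the coset `ℓ • g + H` consists of subset sums of `T`. -/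
def IsFull (H : AddSubgroup G) (g : G) (T : Finset G) (l : ℕ) : Prop :=
  ∀ z, z - l • g ∈ H → z ∈ T.subsetSum

lemma IsFull.card_slice {T : Finset G} {l : ℕ} (h : IsFull H g T l) :
    (slice H g T.subsetSum l).card = Nat.card H := by
  rw [← card_slice_univ (g := g) l]
  congr 1
  ext z
  simp only [mem_slice, Finset.mem_univ, true_and, and_iff_right_iff_imp]
  exact h z

lemma sum_card_slice_le {q : ℕ} (hq : ∀ i < q, ∀ j < q, i • g - j • g ∈ H → i = j)
    (X : Finset G) {I : Finset ℕ} (hI : ∀ i ∈ I, i < q) :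
    ∑ l ∈ I, (slice H g X l).card ≤ X.card := by
  rw [← Finset.card_biUnion]
  · refine Finset.card_le_card fun x hx => ?_
    obtain ⟨l, -, hx⟩ := Finset.mem_biUnion.1 hx
    exact (mem_slice.1 hx).1
  · intro i hi j hj hij
    refine Finset.disjoint_left.2 fun x hxi hxj => hij ?_
    refine hq i (hI i hi) j (hI j hj) ?_
    have := H.sub_mem (mem_slice.1 hxj).2 (mem_slice.1 hxi).2
    simpa using this

/-- Pigeonhole principle in cosets. -/
lemma exists_add_eq_of_card_lt {P Q : Finset G} {i j l : ℕ} {z : G}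
    (hP : ∀ p ∈ P, p - i • g ∈ H) (hQ : ∀ p ∈ Q, p - j • g ∈ H) (hl : l = i + j)
    (hz : z - l • g ∈ H) (hc : Nat.card H < P.card + Q.card) :
    ∃ p ∈ P, ∃ q ∈ Q, p + q = z := by
  by_contra hcon
  push Not at hcon
  have hdis : Disjoint (P.image (z - ·)) Q := by
    refine Finset.disjoint_left.2 fun x hx hxQ => ?_
    obtain ⟨p, hp, rfl⟩ := Finset.mem_image.1 hx
    exact hcon p hp _ hxQ (by abel)
  have hsub : P.image (z - ·) ∪ Q ⊆ slice H g Finset.univ j := by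
    intro x hx
    refine mem_slice.2 ⟨Finset.mem_univ _, ?_⟩
    rcases Finset.mem_union.1 hx with hx | hx
    · obtain ⟨p, hp, rfl⟩ := Finset.mem_image.1 hx
      have := H.sub_mem hz (hP p hp)
      rw [hl, add_nsmul] at this
      convert this using 1
      abel
    · exact hQ x hx
  have := Finset.card_le_card hsub
  rw [Finset.card_union_of_disjoint hdis, Finset.card_image_of_injective _ sub_right_injective,
    card_slice_univ] at this
  omega

lemma IsFull.mono {T T' : Finset G} {l : ℕ} (h : IsFull H g T l) (hT : T ⊆ T') :
    IsFull H g T' l := fun z hz => Finset.subsetSum_mono hT (h z hz)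

/-- Complementation in `T` reflects `Σ(T)` and exchanges levels `l` and `L - l`, where `L` is the
sum of all levels. -/
lemma IsFull.compl {T : Finset G} {lev : G → ℕ} (hlev : ∀ x ∈ T, x - lev x • g ∈ H) {l l' : ℕ}
    (hl : l + l' = ∑ x ∈ T, lev x) (h : IsFull H g T l) : IsFull H g T l' := by
  intro z hz
  have h1 := H.sub_mem (sum_sub_mem hlev) hz
  rw [← hl, add_nsmul] at h1
  have := sum_sub_mem_subsetSum (h (∑ x ∈ T, x - z) (by convert h1 using 1; abel))
  simpa using this

lemma IsFull.union {T B : Finset G} {l i : ℕ} {w : G} (h : IsFull H g T l) (hTB : Disjoint T B)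
    (hw : w ∈ B.subsetSum) (hwi : w - i • g ∈ H) : IsFull H g (T ∪ B) (l + i) := by
  intro z hz
  have h1 := H.sub_mem hz hwi
  rw [add_nsmul] at h1
  have := add_mem_subsetSum_union hTB (h (z - w) (by convert h1 using 1; abel)) hw
  simpa using this

lemma isFull_of_card_lt {A B P Q : Finset G} (hAB : Disjoint A B) (hPA : P ⊆ A.subsetSum)
    (hQB : Q ⊆ B.subsetSum) {i j : ℕ}
    (hP : ∀ p ∈ P, p - i • g ∈ H) (hQ : ∀ p ∈ Q, p - j • g ∈ H)
    (hc : Nat.card H < P.card + Q.card) : IsFull H g (A ∪ B) (i + j) := by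
  intro z hz
  obtain ⟨p, hp, q, hq, rfl⟩ := exists_add_eq_of_card_lt hP hQ rfl hz hc
  exact add_mem_subsetSum_union hAB (hPA hp) (hQB hq)

/-- `Z` lies in `H` and `A` in the coset `j • g + H`. -/
lemma isFull_rSum {Z A : Finset G} (hZA : Disjoint Z A) {j r : ℕ} (hZ : ∀ x ∈ Z, x ∈ H)
    (hA : ∀ x ∈ A, x - j • g ∈ H) (hc : Nat.card H < Z.subsetSum.card + (rSum A r).card) :
    IsFull H g (Z ∪ A) (r * j) := by
  have := isFull_of_card_lt (H := H) (g := g) (i := 0) (j := r * j) hZA subset_rfl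
    (rSum_subset A r) (fun p hp => by simpa using subsetSum_subset_subgroup hZ hp)
    (fun p hp => rSum_sub_mem hA hp) hc
  simpa using this

lemma isFull_level {Z A : Finset G} (hZA : Disjoint Z A) {j : ℕ} (hZ : ∀ x ∈ Z, x ∈ H)
    (hA : ∀ x ∈ A, x - j • g ∈ H) (hA1 : 1 ≤ A.card)
    (hc : Nat.card H < Z.subsetSum.card + A.card) : IsFull H g (Z ∪ A) j := by
  have h1 := card_le_card_rSum_add (A := A) (r := 0) (by omega)
  have := isFull_rSum (r := 1) hZA hZ hA (by simp only [zero_add] at h1; omega)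
  simpa using this

/-- Adding elements of the coset `j • g + H` to a set all of whose middle cosets are full. -/
lemma isFull_union_of_range {T A : Finset G} (hTA : Disjoint T A) {e L j : ℕ}
    (hT : ∀ l, e ≤ l → l + e ≤ L → IsFull H g T l) (hj : j + 2 * e ≤ L + 1)
    (hA : ∀ x ∈ A, x - j • g ∈ H) :
    ∀ l, e ≤ l → l + e ≤ L + A.card * j → IsFull H g (T ∪ A) l := by
  induction A using Finset.induction_on with
  | empty => simpa using hT
  | insert x A hx ih =>
    rw [Finset.disjoint_insert_right] at hTA
    have ih := ih hTA.2 fun y hy => hA y (Finset.mem_insert_of_mem hy)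
    intro l hl hl'
    rw [Finset.card_insert_of_notMem hx, add_mul, one_mul] at hl'
    by_cases h : l + e ≤ L + A.card * j
    · exact (ih l hl h).mono (Finset.union_subset_union_right (Finset.subset_insert _ _))
    -- By `hj` the range of full levels has length at least `j`, so shifting it by `j` leaves no
    -- gap.
    · have := (ih (l - j) (by omega) (by omega)).union (B := {x}) (by simp [hTA.1, hx])
        (Finset.subset_subsetSum (Finset.mem_singleton_self x))
        (hA x (Finset.mem_insert_self _ _))
      rw [Nat.sub_add_cancel (by omega)] at this
      exact this.mono (by intro y; simp)

lemma sum_filter_succ (S : Finset G) (lev : G → ℕ) (j : ℕ) :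
    ∑ x ∈ S with lev x ≤ j + 1, lev x =
      ∑ x ∈ S with lev x ≤ j, lev x + (S.filter fun x => lev x = j + 1).card * (j + 1) := by
  have hdis : Disjoint (S.filter fun x => lev x ≤ j) (S.filter fun x => lev x = j + 1) :=
    Finset.disjoint_filter.2 fun x _ h => by omega
  have hun : (S.filter fun x => lev x ≤ j + 1) =
      (S.filter fun x => lev x ≤ j) ∪ (S.filter fun x => lev x = j + 1) := by
    ext x
    simp only [Finset.mem_filter, Finset.mem_union, ← and_or_left]
    exact and_congr_right fun _ => by omega
  rw [hun, Finset.sum_union hdis, Finset.sum_const_nat (s := S.filter fun x => lev x = j + 1) (m := j + 1)]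
  intro x hx
  exact (Finset.mem_filter.1 hx).2

lemma isFull_of_levels {S : Finset G} {lev : G → ℕ} (hlev : ∀ x ∈ S, x - lev x • g ∈ H)
    {e i m : ℕ} (him : i ≤ m)
    (hbase : ∀ l, e ≤ l → l + e ≤ ∑ x ∈ S with lev x ≤ i, lev x →
      IsFull H g (S.filter fun x => lev x ≤ i) l)
    (hi : i + 2 * e ≤ ∑ x ∈ S with lev x ≤ i, lev x)
    (hne : ∀ j, i < j → j ≤ m → 1 ≤ (S.filter fun x => lev x = j).card) :
    (∀ l, e ≤ l → l + e ≤ ∑ x ∈ S with lev x ≤ m, lev x →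
      IsFull H g (S.filter fun x => lev x ≤ m) l) ∧
    m + 2 * e ≤ ∑ x ∈ S with lev x ≤ m, lev x := by
  induction m, him using Nat.le_induction with
  | base => exact ⟨hbase, hi⟩
  | succ j hij ih =>
    obtain ⟨ih1, ih2⟩ := ih fun j' h h' => hne j' h (by omega)
    have hdis : Disjoint (S.filter fun x => lev x ≤ j) (S.filter fun x => lev x = j + 1) :=
      Finset.disjoint_filter.2 fun x _ h => by omega
    have hun : (S.filter fun x => lev x ≤ j) ∪ (S.filter fun x => lev x = j + 1) ⊆
        (S.filter fun x => lev x ≤ j + 1) := by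
      intro x
      simp only [Finset.mem_filter, Finset.mem_union, ← and_or_left]
      exact And.imp_right fun _ => by omega
    rw [sum_filter_succ]
    constructor
    · intro l hl hl'
      refine (isFull_union_of_range hdis ih1 (by omega) ?_ l hl hl').mono hun
      intro x hx
      rw [Finset.mem_filter] at hx
      exact hx.2 ▸ hlev x hx.1
    · have := hne (j + 1) (by omega) le_rfl
      nlinarith

/-- Two nearly full cosets at levels one and two. -/
lemma isFull_two_levels {Z A B : Finset G} (hZA : Disjoint Z A) (hZB : Disjoint Z B)
    (hAB : Disjoint A B) (hZ : ∀ x ∈ Z, x ∈ H) (hA : ∀ x ∈ A, x - 1 • g ∈ H)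
    (hB : ∀ x ∈ B, x - 2 • g ∈ H) (hA2 : 2 ≤ A.card) (hB1 : 1 ≤ B.card)
    (hAH : Nat.card H < Z.subsetSum.card + A.card)
    (hBH : Nat.card H < Z.subsetSum.card + B.card)
    (hABH : 2 * Nat.card H < 2 * A.card + B.card) (hAB' : A.card ≤ 2 * B.card + 2)
    {lev : G → ℕ} (hlev : ∀ x ∈ Z ∪ A ∪ B, x - lev x • g ∈ H)
    (hL : ∑ x ∈ Z ∪ A ∪ B, lev x = A.card + 2 * B.card) :
    ∀ l, 1 ≤ l → l + 1 ≤ A.card + 2 * B.card → IsFull H g (Z ∪ A ∪ B) l := by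
  have hlow : ∀ l, 1 ≤ l → l ≤ 2 * B.card + 1 → IsFull H g (Z ∪ A ∪ B) l := by
    intro l hl hl'
    rcases Nat.even_or_odd' l with ⟨c, rfl | rfl⟩
    · obtain rfl | hc := eq_or_ne c 1
      · exact (isFull_level hZB hZ hB hB1 hBH).mono
          (by intro x; simp only [Finset.mem_union]; tauto)
      · obtain ⟨c, rfl⟩ : ∃ c', c = c' + 1 := ⟨c - 1, by omega⟩
        -- Level `2(c + 1)` is reached with two elements of `A` and `c` of `B`. Averaging the two
        -- bounds for `rSum B c` gives at least `|B|/2 + 1`; with `|A| - 1` sums from `A` this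
        -- exceeds `|H|` by `hABH`.
        have h1 := card_le_card_rSum_add (A := A) (r := 1) (by omega)
        have h2 := lt_card_rSum (A := B) (r := c) (by omega)
        have h3 := card_le_card_rSum_add (A := B) (r := c - 1) (by omega)
        rw [Nat.sub_add_cancel (by omega)] at h3
        have := isFull_of_card_lt (H := H) (g := g) hAB (rSum_subset A 2) (rSum_subset B c)
          (fun p hp => rSum_sub_mem hA hp) (fun p hp => rSum_sub_mem hB hp)
          (by simp only [Nat.reduceAdd] at h1; omega)
        rw [show 2 * 1 + c * 2 = 2 * (c + 1) by ring] at this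
        exact this.mono (by intro x; simp only [Finset.mem_union]; tauto)
    · obtain ⟨w, hw⟩ := rSum_nonempty (A := B) (r := c) (by omega)
      have := (isFull_level hZA hZ hA (by omega) hAH).union (Finset.disjoint_union_left.2 ⟨hZB, hAB⟩)
        (rSum_subset B c hw) (rSum_sub_mem hB hw)
      rwa [show 1 + c * 2 = 2 * c + 1 by ring] at this
  intro l hl hl'
  by_cases h : l ≤ 2 * B.card + 1
  · exact hlow l hl h
  -- The upper levels are reflections of the lower ones; `hAB'` ensures that the two ranges meet.
  · exact (hlow (A.card + 2 * B.card - l) (by omega) (by omega)).compl hlev (by omega)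

end Slice

/-! ### Numerical inequalities, with `h = |H|`, `k = |Z|`, `n = |Σ(Z)|`, `s = |T|`, `a` the size of
level one. -/

lemma quadratic_bound_of_full {h m k t n L s : ℕ} (hs : s = m * h + t) (ht : t ≤ k)
    (hk : 4 * k ≤ h) (hn : 2 * k ≤ n) (hn1 : 1 ≤ n) (hs4 : 4 ≤ s) (hm : 1 ≤ m) (hh : 1 ≤ h)
    (hL : h * m * (m + 1) + 2 * m * t ≤ 2 * L + 2 * m * k) (hL1 : 1 ≤ L) :
    s * (s + 1) + 2 ≤ 2 * (2 * n + (L - 1) * h) := by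
  obtain ⟨L, rfl⟩ : ∃ L', L = L' + 1 := ⟨L - 1, by omega⟩
  rw [Nat.add_sub_cancel]
  zify at *
  have hLh := mul_le_mul_of_nonneg_right hL (by positivity : (0 : ℤ) ≤ h)
  -- This is what remains of the claim after inserting `s = mh + t` and `h` times the lower bound
  -- `hL`.
  have key : (t : ℤ) * t + t + 2 + 2 * h ≤ 4 * n + m * h * (h - 2 * k - 1) := by
    rcases Nat.eq_zero_or_pos k with rfl | hk0
    · obtain rfl : t = 0 := by omega
      have : (0 : ℤ) ≤ (h - 1) * (m * h - 2) :=
        mul_nonneg (by linarith) (by push_cast at hs; linarith)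
      push_cast at *
      nlinarith
    · zify at hk0
      have h1 : (h : ℤ) * (h - 2 * k - 1) ≤ m * h * (h - 2 * k - 1) :=
        mul_le_mul_of_nonneg_right (by nlinarith) (by linarith)
      have h2 : (t : ℤ) * t ≤ k * k := by nlinarith
      obtain ⟨u, hu⟩ : ∃ u : ℤ, (h : ℤ) = 4 * k + u := ⟨h - 4 * k, by ring⟩
      have hu0 : 0 ≤ u := by linarith
      have h3 : (0 : ℤ) ≤ u * u + 3 * u * (2 * k - 1) + (k - 1) * (7 * k + 2) := by
        have := mul_nonneg hu0 (by linarith : (0 : ℤ) ≤ 2 * k - 1)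
        have := mul_nonneg (by linarith : (0 : ℤ) ≤ (k : ℤ) - 1) (by linarith : (0 : ℤ) ≤ 7 * k + 2)
        nlinarith
      rw [hu] at h1 ⊢
      nlinarith
  rw [hs]
  nlinarith

/-- The right side is twice the count from two end cosets with `n` sums each, `p` full cosets next
to each end, and `a - 1 - 2p` middle cosets with at least `(a + 2)/2` sums each. -/
lemma quadratic_bound_of_level_one {h k t n a s p : ℕ} (hs : s = h + t) (ha : a + k = s)
    (ht : t ≤ k) (hk : 4 * k ≤ h) (hn : 2 * k ≤ n) (hn1 : 1 ≤ n) (hh : 2 ≤ h)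
    (hp : p = max 1 (k + t)) (hpa : 2 * p + 1 ≤ a) :
    s * (s + 1) + 2 ≤ 4 * n + 4 * (p * h) + (a - 1 - 2 * p) * (a + 2) := by
  obtain ⟨b, rfl⟩ : ∃ b, a = b + 1 + 2 * p := ⟨a - 1 - 2 * p, by omega⟩
  rw [show b + 1 + 2 * p - 1 - 2 * p = b by omega]
  rcases Nat.eq_zero_or_pos k with rfl | hk0
  · obtain rfl : t = 0 := by omega
    obtain rfl : p = 1 := by omega
    obtain rfl : h = b + 3 := by omega
    subst hs
    nlinarith
  · obtain rfl : p = k + t := by omega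
    have hb : (b : ℤ) = h - t - 3 * k - 1 := by omega
    zify at *
    rw [hb, hs]
    have h1 : (0 : ℤ) ≤ t * (2 * h - 2 * t - 2 * k - 4) := mul_nonneg (by positivity) (by linarith)
    nlinarith

/-- When the levels wrap around, `p` full cosets and `q - 1 - p` cosets with at least `(a + 2)/2`
sums already exceed half of the `qh` elements of `G`. -/
lemma wrap_bound_of_level_one {h k t n a p q : ℕ} (ha : a + k = h + t) (ht : t ≤ k)
    (hn : 2 * k ≤ n) (hk : 4 * k ≤ h) (hh : 1 ≤ h)
    (hp : p = max 1 (k + t)) (hqa : q ≤ a) (hpq : p < q - 1) :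
    q * h < 2 * (p * h) + (q - 1 - p) * (a + 2) := by
  obtain ⟨c, rfl⟩ : ∃ c, q = c + 1 + p := ⟨q - 1 - p, by omega⟩
  rw [show c + 1 + p - 1 - p = c by omega]
  have hc : 1 ≤ c := by omega
  have hch : c + 1 + p + k ≤ h + t := by omega
  have hpk : k ≤ p ∧ 1 ≤ p := by omega
  have h1 : c * (h + 2) ≤ c * (a + 2) + c * k := by
    rw [← mul_add]
    exact Nat.mul_le_mul_left _ (by omega)
  rcases Nat.lt_or_ge k 2 with hk2 | hk2
  · interval_cases k <;> nlinarith
  · have h2 : c * (k - 2) < h * (p - 1) := by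
      have : c * (k - 2) ≤ h * (k - 2) := Nat.mul_le_mul_right _ (by omega)
      have : h * (k - 2) < h * (p - 1) := Nat.mul_lt_mul_of_pos_left (by omega) (by omega)
      omega
    obtain ⟨k, rfl⟩ : ∃ k', k = k' + 2 := ⟨k - 2, by omega⟩
    obtain ⟨p, rfl⟩ : ∃ p', p = p' + 1 := ⟨p - 1, by omega⟩
    simp only [Nat.add_sub_cancel] at h2
    nlinarith

/-! ### Counting subset sums coset by coset. -/

section Count

variable {G : Type*} [AddCommGroup G] [Fintype G] [DecidableEq G] {H : AddSubgroup G} {g : G}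

lemma card_subsetSum_le_slice_zero {T Z : Finset G} (hZT : Z ⊆ T) (hZ : ∀ x ∈ Z, x ∈ H) :
    Z.subsetSum.card ≤ (slice H g T.subsetSum 0).card := by
  refine Finset.card_le_card fun x hx => mem_slice.2 ⟨Finset.subsetSum_mono hZT hx, ?_⟩
  simpa using subsetSum_subset_subgroup hZ hx

lemma card_subsetSum_le_slice_top {T Z : Finset G} {lev : G → ℕ}
    (hlev : ∀ x ∈ T, x - lev x • g ∈ H) (hZT : Z ⊆ T) (hZ : ∀ x ∈ Z, x ∈ H) :
    Z.subsetSum.card ≤ (slice H g T.subsetSum (∑ x ∈ T, lev x)).card := by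
  rw [← Finset.card_image_of_injective Z.subsetSum
    (sub_right_injective (b := ∑ x ∈ T, x))]
  refine Finset.card_le_card fun y hy => ?_
  obtain ⟨x, hx, rfl⟩ := Finset.mem_image.1 hy
  refine mem_slice.2 ⟨sum_sub_mem_subsetSum (Finset.subsetSum_mono hZT hx), ?_⟩
  have := H.sub_mem (sum_sub_mem hlev) (subsetSum_subset_subgroup hZ hx)
  convert this using 1
  abel

/-- The end levels `0` and `L` contain `Σ(Z)` and its reflection; the `L - 1` levels between are
full. -/
lemma card_ge_of_full {T Z : Finset G} {lev : G → ℕ} {q : ℕ}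
    (hq : ∀ i < q, ∀ j < q, i • g - j • g ∈ H → i = j) (hq3 : 3 ≤ q)
    (hlev : ∀ x ∈ T, x - lev x • g ∈ H) (hZT : Z ⊆ T) (hZ : ∀ x ∈ Z, x ∈ H)
    (hL1 : 1 ≤ ∑ x ∈ T, lev x)
    (hfull : ∀ l, 1 ≤ l → l + 1 ≤ ∑ x ∈ T, lev x → IsFull H g T l)
    (hhalf : 2 * T.subsetSum.card ≤ q * Nat.card H) :
    2 * Z.subsetSum.card + (∑ x ∈ T, lev x - 1) * Nat.card H ≤ T.subsetSum.card := by
  have h0 := card_subsetSum_le_slice_zero (g := g) hZT hZ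
  have h1 := card_subsetSum_le_slice_top hlev hZT hZ
  set L := ∑ x ∈ T, lev x with hL
  have hsum : ∀ n, n + 1 ≤ L → ∑ l ∈ Finset.Ico 1 (n + 1), (slice H g T.subsetSum l).card
      = n * Nat.card H := by
    intro n hn
    rw [Finset.sum_congr rfl (g := fun _ => Nat.card H)]
    · simp
    · intro l hl
      rw [Finset.mem_Ico] at hl
      exact (hfull l hl.1 (by omega)).card_slice
  have hHpos : 0 < Nat.card H := Nat.card_pos
  by_cases hqL : L < q
  · obtain ⟨n, hn⟩ : ∃ n, L = n + 1 := ⟨L - 1, by omega⟩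
    have := sum_card_slice_le hq T.subsetSum (I := Finset.range (L + 1))
      (fun i hi => by rw [Finset.mem_range] at hi; omega)
    rw [Finset.sum_range_succ, Finset.range_eq_Ico, Finset.sum_eq_sum_Ico_succ_bot (by omega),
      hn, zero_add, hsum n (by omega), ← hn] at this
    rw [show L - 1 = n by omega]
    omega
  -- If `L ≥ q`, levels `1, …, q - 1` are distinct full cosets, more than half of `G` because `q ≥
  -- 3`.
  · exfalso
    have := sum_card_slice_le hq T.subsetSum (I := Finset.Ico 1 (q - 1 + 1))
      (fun i hi => by rw [Finset.mem_Ico] at hi; omega)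
    rw [hsum (q - 1) (by omega)] at this
    obtain ⟨q, rfl⟩ : ∃ q', q = q' + 3 := ⟨q - 3, by omega⟩
    rw [show q + 3 - 1 = q + 2 by omega] at this
    nlinarith

/-- The case in which the progression consists of `-1, 0, 1` only. -/
lemma card_ge_of_level_one {T Z A : Finset G} {lev : G → ℕ} {q k t s : ℕ}
    (hq : ∀ i < q, ∀ j < q, i • g - j • g ∈ H → i = j) (hq3 : 3 ≤ q)
    (hlev : ∀ x ∈ T, x - lev x • g ∈ H) (hT : T = Z ∪ A) (hZA : Disjoint Z A)
    (hZ : ∀ x ∈ Z, x ∈ H) (hA : ∀ x ∈ A, x - 1 • g ∈ H) (hL : ∑ x ∈ T, lev x = A.card)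
    (hs : s = Nat.card H + t) (ha : A.card + k = s) (ht : t ≤ k) (hk : 4 * k ≤ Nat.card H)
    (hn : 2 * k ≤ Z.subsetSum.card) (hs4 : 4 ≤ s)
    (hhalf : 2 * T.subsetSum.card ≤ q * Nat.card H) :
    s * (s + 1) + 2 ≤ 2 * T.subsetSum.card := by
  have hn1 : 1 ≤ Z.subsetSum.card := Finset.card_pos.2 Finset.subsetSum_nonempty
  have hHpos : 0 < Nat.card H := Nat.card_pos
  -- Level `l` is full once `|Σ(Z)| + |A| - l + 1 > h`. Since `|A| = h + t - k` and `|Σ(Z)| ≥ 2k`,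
  -- this holds for `l ≤ k + t`; for `k = 0` the empty sum in `Σ(Z)` still gives `l = 1`.
  obtain ⟨p, hp⟩ : ∃ p, p = max 1 (k + t) := ⟨_, rfl⟩
  have hlow : ∀ l, 1 ≤ l → l ≤ p → l + 1 ≤ A.card → IsFull H g T l := by
    intro l hl hlp hla
    have h1 := card_le_card_rSum_add (A := A) (r := l - 1) (by omega)
    rw [Nat.sub_add_cancel hl] at h1
    have := isFull_rSum (H := H) (r := l) hZA hZ hA (by omega)
    rwa [mul_one, ← hT] at this
  have hhigh : ∀ l, A.card ≤ l + p → 1 ≤ l → l + 1 ≤ A.card → IsFull H g T l := by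
    intro l hlp hl hla
    exact (hlow (A.card - l) (by omega) (by omega) (by omega)).compl hlev (by omega)
  have hZT : Z ⊆ T := hT ▸ Finset.subset_union_left
  by_cases hpa : A.card ≤ 2 * p + 1
  · have := card_ge_of_full hq hq3 hlev hZT hZ (by omega)
      (fun l hl hl' => by
        by_cases h : l ≤ p
        · exact hlow l hl h (by omega)
        · exact hhigh l (by omega) hl (by omega)) hhalf
    rw [hL] at this
    have h2 := quadratic_bound_of_full (h := Nat.card H) (m := 1) (n := Z.subsetSum.card)
      (L := A.card) (by simpa using hs) ht hk hn hn1 hs4 le_rfl hHpos (by nlinarith) (by omega)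
    omega
  · have h0 := card_subsetSum_le_slice_zero (g := g) hZT hZ
    have h1 := card_subsetSum_le_slice_top hlev hZT hZ
    rw [hL] at h1
    have hfull : ∀ i j, (∀ l, i ≤ l → l < j → IsFull H g T l) →
        ∑ l ∈ Finset.Ico i j, (slice H g T.subsetSum l).card = (j - i) * Nat.card H := by
      intro i j hij
      rw [Finset.sum_congr rfl (g := fun _ => Nat.card H)]
      · simp
      · intro l hl
        rw [Finset.mem_Ico] at hl
        exact (hij l hl.1 hl.2).card_slice
    have hmid : ∀ i j, 1 ≤ i → j ≤ A.card → (j - i) * (A.card + 2) ≤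
        2 * ∑ l ∈ Finset.Ico i j, (slice H g T.subsetSum l).card := by
      intro i j hi hj
      rw [Finset.mul_sum, ← Nat.card_Ico i j, ← smul_eq_mul]
      refine Finset.card_nsmul_le_sum _ _ _ fun l hl => ?_
      rw [Finset.mem_Ico] at hl
      -- The average of the bounds `|A| - l + 1` and `l + 1` does not depend on `l`.
      have h1 := card_le_card_rSum_add (A := A) (r := l - 1) (by omega)
      have h2 := lt_card_rSum (A := A) (r := l) (by omega)
      rw [Nat.sub_add_cancel (by omega)] at h1
      have h3 : (rSum A l).card ≤ (slice H g T.subsetSum l).card := by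
        refine Finset.card_le_card fun x hx => mem_slice.2 ⟨?_, ?_⟩
        · exact Finset.subsetSum_mono (hT ▸ Finset.subset_union_right) (rSum_subset A l hx)
        · simpa using rSum_sub_mem hA hx
      omega
    by_cases hqa : A.card < q
    · have h2 := sum_card_slice_le hq T.subsetSum (I := Finset.range (A.card + 1))
        (fun i hi => by rw [Finset.mem_range] at hi; omega)
      rw [Finset.sum_range_succ, Finset.range_eq_Ico,
        ← Finset.sum_Ico_consecutive _ (Nat.zero_le 1) (by omega : 1 ≤ A.card),
        ← Finset.sum_Ico_consecutive _ (by omega : 1 ≤ p + 1) (by omega : p + 1 ≤ A.card),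
        ← Finset.sum_Ico_consecutive _ (by omega : p + 1 ≤ A.card - p)
          (by omega : A.card - p ≤ A.card),
        hfull 1 (p + 1) (fun l hl hl' => hlow l hl (by omega) (by omega)),
        hfull (A.card - p) A.card (fun l hl hl' => hhigh l (by omega) (by omega) (by omega)),
        Nat.Ico_succ_singleton, Finset.sum_singleton,
        show p + 1 - 1 = p by omega, show A.card - (A.card - p) = p by omega] at h2
      have h3 := hmid (p + 1) (A.card - p) (by omega) (by omega)
      rw [show A.card - p - (p + 1) = A.card - 1 - 2 * p by omega] at h3
      have h4 := quadratic_bound_of_level_one (p := p) hs ha ht hk hn hn1 (by omega) hp (by omega)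
      omega
    · exfalso
      have h2 := sum_card_slice_le hq T.subsetSum (I := Finset.Ico 1 q)
        (fun i hi => by rw [Finset.mem_Ico] at hi; omega)
      by_cases hpq : p < q - 1
      · have h3 := hmid (p + 1) q (by omega) (by omega)
        rw [← Finset.sum_Ico_consecutive _ (by omega : 1 ≤ p + 1) (by omega : p + 1 ≤ q),
          hfull 1 (p + 1) (fun l hl hl' => hlow l hl (by omega) (by omega)),
          show p + 1 - 1 = p by omega] at h2
        have h4 := wrap_bound_of_level_one (q := q) (ha.trans hs) ht hn hk hHpos hp
          (by omega) hpq
        rw [show q - (p + 1) = q - 1 - p by omega] at h3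
        omega
      · rw [hfull 1 q (fun l hl hl' => hlow l hl (by omega) (by omega))] at h2
        obtain ⟨q, rfl⟩ : ∃ q', q = q' + 3 := ⟨q - 3, by omega⟩
        rw [show q + 3 - 1 = q + 2 by omega] at h2
        nlinarith

end Count

/-! ### Sizes of the levels, and the bound for sets on levels `0, …, m`. -/

section Levels

variable {G : Type*} [AddCommGroup G] [Fintype G] [DecidableEq G] {H : AddSubgroup G} {g : G}

lemma card_level_le {T : Finset G} {lev : G → ℕ} (hlev : ∀ x ∈ T, x - lev x • g ∈ H) (j : ℕ) :
    (T.filter fun x => lev x = j).card ≤ Nat.card H := by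
  rw [← card_slice_univ (g := g) j]
  refine Finset.card_le_card fun x hx => mem_slice.2 ⟨Finset.mem_univ _, ?_⟩
  rw [Finset.mem_filter] at hx
  exact hx.2 ▸ hlev x hx.1

lemma card_eq_sum_levels {T : Finset G} {lev : G → ℕ} {m : ℕ} (hm : ∀ x ∈ T, lev x ≤ m) :
    T.card = ∑ j ∈ Finset.range m, (T.filter fun x => lev x = j + 1).card +
      (T.filter fun x => lev x = 0).card := by
  rw [Finset.card_eq_sum_card_fiberwise (f := lev) (t := Finset.range (m + 1)),
    Finset.sum_range_succ']
  intro x hx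
  simpa using Nat.lt_succ_of_le (hm x hx)

/-- If the set is large, every positive level is nearly full. -/
lemma card_le_card_level_add {T : Finset G} {lev : G → ℕ} {m : ℕ} (hm : ∀ x ∈ T, lev x ≤ m)
    (hlev : ∀ x ∈ T, x - lev x • g ∈ H) {t : ℕ} (hs : T.card = m * Nat.card H + t)
    {j : ℕ} (hj : 1 ≤ j) (hjm : j ≤ m) :
    Nat.card H + t ≤ (T.filter fun x => lev x = j).card +
      (T.filter fun x => lev x = 0).card := by
  obtain ⟨j, rfl⟩ : ∃ j', j = j' + 1 := ⟨j - 1, by omega⟩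
  obtain ⟨m, rfl⟩ : ∃ m', m = m' + 1 := ⟨m - 1, by omega⟩
  have h1 := card_eq_sum_levels hm
  have hmem : j ∈ Finset.range (m + 1) := by simpa using by omega
  rw [← Finset.add_sum_erase _ _ hmem] at h1
  have h2 : ∑ i ∈ (Finset.range (m + 1)).erase j, (T.filter fun x => lev x = i + 1).card ≤
      m * Nat.card H := by
    have := Finset.sum_le_card_nsmul ((Finset.range (m + 1)).erase j)
      (fun i => (T.filter fun x => lev x = i + 1).card) (Nat.card H)
      (fun i _ => card_level_le hlev (i + 1))
    rwa [Finset.card_erase_of_mem hmem, Finset.card_range, smul_eq_mul, Nat.add_sub_cancel] at this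
  rw [hs, add_mul, one_mul] at h1
  omega

/-- The deficits `m - lev x` add up to at most `mk` on level zero and `h(0 + 1 + ⋯ + (m - 1))` on
the positive levels. -/
lemma sum_levels_ge {T : Finset G} {lev : G → ℕ} {m : ℕ} (hm : ∀ x ∈ T, lev x ≤ m)
    (hlev : ∀ x ∈ T, x - lev x • g ∈ H) {t : ℕ} (hs : T.card = m * Nat.card H + t) :
    Nat.card H * m * (m + 1) + 2 * m * t ≤
      2 * ∑ x ∈ T, lev x + 2 * m * (T.filter fun x => lev x = 0).card := by
  have h1 : ∑ x ∈ T, (m - lev x) + ∑ x ∈ T, lev x = T.card * m := by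
    rw [← Finset.sum_add_distrib, Finset.sum_const_nat]
    intro x hx
    exact Nat.sub_add_cancel (hm x hx)
  have h2 : ∑ x ∈ T, (m - lev x) =
      ∑ j ∈ Finset.range (m + 1), (T.filter fun x => lev x = j).card * (m - j) := by
    rw [← Finset.sum_fiberwise_of_maps_to (g := lev) (t := Finset.range (m + 1))]
    · refine Finset.sum_congr rfl fun j _ => Finset.sum_const_nat fun x hx => ?_
      rw [(Finset.mem_filter.1 hx).2]
    · intro x hx
      simpa using Nat.lt_succ_of_le (hm x hx)
  have h3 : ∑ j ∈ Finset.range m, (T.filter fun x => lev x = j + 1).card * (m - (j + 1)) ≤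
      Nat.card H * ∑ j ∈ Finset.range m, j := by
    rw [← Finset.sum_range_reflect (fun j => j), Finset.mul_sum]
    refine Finset.sum_le_sum fun j _ => ?_
    rw [show m - 1 - j = m - (j + 1) by omega]
    exact Nat.mul_le_mul_right _ (card_level_le hlev _)
  rw [Finset.sum_range_succ', Nat.sub_zero] at h2
  have h4 := Finset.sum_range_id_mul_two m
  have h5 : Nat.card H * (m * (m - 1)) + Nat.card H * m * 2 = Nat.card H * m * (m + 1) := by
    cases m with
    | zero => simp
    | succ m => rw [Nat.add_sub_cancel]; ring
  have h6 : Nat.card H * (∑ j ∈ Finset.range m, j) * 2 = Nat.card H * (m * (m - 1)) := by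
    rw [mul_assoc, h4]
  have h7 : (m * Nat.card H + t) * m + m * Nat.card H * m = 2 * (m * Nat.card H * m) + m * t := by
    ring
  rw [hs] at h1
  nlinarith

/-- A set `T` whose elements occupy the levels `0, …, m` of `G / H`, and which is so large that
the levels `1, …, m` are nearly full. -/
theorem card_subsetSum_ge_of_levels {T : Finset G} {lev : G → ℕ} {q m : ℕ}
    (hq : ∀ i < q, ∀ j < q, i • g - j • g ∈ H → i = j) (hq3 : 3 ≤ q)
    (hG : Nat.card G = q * Nat.card H) (hanti : ∀ x ∈ T, -x ∉ T) (hT4 : 4 ≤ T.card)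
    (hm : ∀ x ∈ T, lev x ≤ m) (hm1 : 1 ≤ m) (hlev : ∀ x ∈ T, x - lev x • g ∈ H)
    (hmT : m * Nat.card H ≤ T.card)
    (hgen : AddSubgroup.closure (T : Set G) = ⊤)
    (hhalf : ∀ T' ⊆ T, T'.Nonempty →
      2 * T'.subsetSum.card ≤ Nat.card (AddSubgroup.closure (T' : Set G))) :
    T.card * (T.card + 1) + 2 ≤ 2 * T.subsetSum.card := by
  have hHpos : 0 < Nat.card H := Nat.card_pos
  have hTne : T.Nonempty := Finset.card_pos.1 (by omega)
  have hT2 : 2 * T.subsetSum.card ≤ q * Nat.card H := by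
    have := hhalf T subset_rfl hTne
    rwa [hgen, AddSubgroup.card_top, hG] at this
  obtain ⟨t, hs⟩ := Nat.exists_eq_add_of_le hmT
  set Z := T.filter fun x => lev x = 0 with hZdef
  have hZT : Z ⊆ T := Finset.filter_subset _ _
  have hZ : ∀ x ∈ Z, x ∈ H := by
    intro x hx
    rw [hZdef, Finset.mem_filter] at hx
    simpa [hx.2] using hlev x hx.1
  have hn : 2 * Z.card ≤ Z.subsetSum.card :=
    two_mul_card_le_card_subsetSum Z (fun x hx hx' => hanti x (hZT hx) (hZT hx'))
      fun T' hT' => hhalf T' (hT'.trans hZT)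
  have hn1 : 1 ≤ Z.subsetSum.card := Finset.card_pos.2 Finset.subsetSum_nonempty
  have hk : 4 * Z.card ≤ Nat.card H := by
    rcases Z.eq_empty_or_nonempty with h | h
    · simp [h]
    · have h1 := hhalf Z hZT h
      have h2 : Nat.card (AddSubgroup.closure (Z : Set G)) ≤ Nat.card H :=
        Nat.card_mono (Set.toFinite _) ((AddSubgroup.closure_le H).2 fun x hx => hZ x hx)
      omega
  have ht : t ≤ Z.card := by
    have h1 := card_eq_sum_levels hm
    have h2 := Finset.sum_le_card_nsmul (Finset.range m)
      (fun i => (T.filter fun x => lev x = i + 1).card) (Nat.card H)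
      (fun i _ => card_level_le hlev (i + 1))
    rw [Finset.card_range, smul_eq_mul] at h2
    rw [← hZdef] at h1
    omega
  have ha : ∀ j, 1 ≤ j → j ≤ m →
      Nat.card H + t ≤ (T.filter fun x => lev x = j).card + Z.card :=
    fun j hj hjm => card_le_card_level_add hm hlev hs hj hjm
  have hmem : ∀ j, ∀ x ∈ T.filter (fun x => lev x = j), x - j • g ∈ H := by
    intro j x hx
    rw [Finset.mem_filter] at hx
    exact hx.2 ▸ hlev x hx.1
  have hdis : ∀ i j, i ≠ j → Disjoint (T.filter fun x => lev x = i) (T.filter fun x => lev x = j) :=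
    fun i j hij => Finset.disjoint_filter.2 fun x _ h => by omega
  have hTm : (T.filter fun x => lev x ≤ m) = T := Finset.filter_true_of_mem hm
  rcases Nat.lt_or_ge m 2 with hm2 | hm2
  · obtain rfl : m = 1 := by omega
    have hc := card_eq_sum_levels hm
    rw [Finset.sum_range_one, zero_add] at hc
    have hTu : T = Z ∪ T.filter fun x => lev x = 1 := by
      ext x
      simp only [hZdef, Finset.mem_union, Finset.mem_filter, ← and_or_left]
      exact ⟨fun h => ⟨h, by have := hm x h; omega⟩, fun h => h.1⟩
    have hL := sum_filter_succ T lev 0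
    rw [zero_add, hTm, Finset.sum_eq_zero (s := T.filter fun x => lev x ≤ 0) (fun x hx => by
      have := (Finset.mem_filter.1 hx).2; omega), zero_add, mul_one] at hL
    exact card_ge_of_level_one hq hq3 hlev hTu (hdis 0 1 (by omega)) hZ (hmem 1) hL
      (by rw [hs, one_mul]) hc.symm ht hk hn hT4 hT2
  have hfull : ∀ l, 1 ≤ l → l + 1 ≤ ∑ x ∈ T, lev x → IsFull H g T l := by
    -- For trivial `H` level one has a single element, too few for `isFull_two_levels`. But then the
    -- coset `0` is itself full, and the induction starts at level zero with no end levels excluded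
    -- (`e = 0`).
    rcases Nat.lt_or_ge (Nat.card H) 2 with hh | hh
    · have h1 := (isFull_of_levels hlev (e := 0) (Nat.zero_le m) ?_ (by simp) ?_).1
      · rw [hTm] at h1
        exact fun l _ hl' => h1 l (Nat.zero_le l) (by omega)
      · intro l _ hl
        rw [Finset.sum_eq_zero (fun x hx => by
          have := (Finset.mem_filter.1 hx).2; omega)] at hl
        obtain rfl : l = 0 := by omega
        intro z hz
        have : H = ⊥ := AddSubgroup.card_eq_one.1 (by omega)
        rw [this, AddSubgroup.mem_bot, zero_nsmul, sub_zero] at hz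
        simp [hz]
      · intro j hj hjm
        have := ha j hj hjm
        omega
    · have hT2u : (T.filter fun x => lev x ≤ 2) =
          Z ∪ (T.filter fun x => lev x = 1) ∪ (T.filter fun x => lev x = 2) := by
        ext x
        simp only [hZdef, Finset.mem_union, Finset.mem_filter, ← and_or_left]
        exact and_congr_right fun _ => by omega
      have hL := sum_filter_succ T lev 1
      rw [sum_filter_succ T lev 0,
        Finset.sum_eq_zero (s := T.filter fun x => lev x ≤ 0) (fun x hx => by
          have := (Finset.mem_filter.1 hx).2; omega)] at hL
      simp only [zero_add, mul_one, Nat.reduceAdd] at hL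
      have ha1 := ha 1 le_rfl hm1
      have ha2 := ha 2 (by omega) hm2
      have ha1' := card_level_le hlev 1
      have hbase := isFull_two_levels (Z := Z) (hdis 0 1 (by omega)) (hdis 0 2 (by omega))
        (hdis 1 2 (by omega)) hZ (hmem 1) (hmem 2) (by omega) (by omega) (by omega) (by omega)
        (by omega) (by omega) (lev := lev)
        (fun x hx => hlev x (Finset.filter_subset _ _ (hT2u ▸ hx)))
        (by rw [← hT2u, hL]; ring)
      rw [← hT2u] at hbase
      have h1 := (isFull_of_levels hlev (e := 1) hm2
        (fun l hl hl' => hbase l hl (by rw [hL] at hl'; omega))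
        (by rw [hL]; omega) (fun j hj hjm => by have := ha j (by omega) hjm; omega)).1
      rwa [hTm] at h1
  have hL := sum_levels_ge hm hlev hs
  have hL1 : 1 ≤ ∑ x ∈ T, lev x := by
    have h1 : 1 ≤ (T.filter fun x => lev x = m).card := by
      have := ha m hm1 le_rfl
      omega
    obtain ⟨x, hx⟩ := Finset.card_pos.1 h1
    rw [Finset.mem_filter] at hx
    have := Finset.single_le_sum (f := lev) (fun _ _ => Nat.zero_le _) hx.1
    omega
  have h1 := card_ge_of_full hq hq3 hlev hZT hZ hL1 hfull hT2
  have h2 := quadratic_bound_of_full hs ht hk hn hn1 hT4 hm1 hHpos hL hL1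
  omega

end Levels

/-! ### Invariance under changes of sign. -/

section SignChange

variable {G : Type*} [AddCommGroup G] [DecidableEq G]

lemma injOn_of_sign {S : Finset G} (hS : ∀ x ∈ S, -x ∉ S) {f : G → G}
    (hf : ∀ x, f x = x ∨ f x = -x) : Set.InjOn f S := by
  intro x hx y hy hxy
  rcases hf x with h | h <;> rcases hf y with h' | h' <;> rw [h, h'] at hxy
  · exact hxy
  · exact absurd (hxy ▸ hx) (hS y hy)
  · exact absurd (hxy ▸ hy) (hS x hx)
  · exact neg_injective hxy

/-- Changing the signs of some elements translates the set of subset sums. -/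
lemma card_subsetSum_image_sign_le {S : Finset G} (hS : ∀ x ∈ S, -x ∉ S) {f : G → G}
    (hf : ∀ x, f x = x ∨ f x = -x) : (S.image f).subsetSum.card ≤ S.subsetSum.card := by
  have hinj := injOn_of_sign hS hf
  set N := S.filter fun x => f x ≠ x with hN
  have hsub : (S.image f).subsetSum ⊆ S.subsetSum.image (· - ∑ x ∈ N, x) := by
    intro z hz
    obtain ⟨X, hX, rfl⟩ := Finset.mem_subsetSum_iff.1 hz
    obtain ⟨Y, hY, rfl⟩ := Finset.subset_image_iff.1 hX
    have hYS : Y ⊆ S := hY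
    -- With `N` the set of elements whose sign changes, `Y` corresponds to its symmetric difference
    -- with `N`, and the sums differ by the sum of `N`.
    refine Finset.mem_image.2 ⟨∑ x ∈ (Y \ N) ∪ (N \ Y), x, ?_, ?_⟩
    · exact Finset.mem_subsetSum_iff.2 ⟨_, Finset.union_subset
        (Finset.sdiff_subset.trans hYS) (Finset.sdiff_subset.trans (Finset.filter_subset _ _)), rfl⟩
    · have h1 : ∑ x ∈ Y ∩ N, f x = -∑ x ∈ N ∩ Y, x := by
        rw [Finset.inter_comm, ← Finset.sum_neg_distrib]
        refine Finset.sum_congr rfl fun x hx => (hf x).resolve_left ?_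
        exact (Finset.mem_filter.1 (Finset.mem_inter.1 hx).1).2
      have h2 : ∑ x ∈ Y \ N, f x = ∑ x ∈ Y \ N, x := by
        refine Finset.sum_congr rfl fun x hx => ?_
        rw [Finset.mem_sdiff] at hx
        by_contra h
        exact hx.2 (Finset.mem_filter.2 ⟨hYS hx.1, h⟩)
      rw [Finset.sum_image (hinj.mono hY), Finset.sum_union disjoint_sdiff_sdiff,
        ← Finset.sum_inter_add_sum_sdiff N Y (fun x => x),
        ← Finset.sum_inter_add_sum_sdiff Y N f, h1, h2]
      abel
  exact (Finset.card_le_card hsub).trans Finset.card_image_le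

lemma closure_image_sign {S : Finset G} {f : G → G} (hf : ∀ x, f x = x ∨ f x = -x) :
    AddSubgroup.closure ((S.image f : Finset G) : Set G) = AddSubgroup.closure (S : Set G) := by
  refine le_antisymm ((AddSubgroup.closure_le _).2 fun y hy => ?_)
    ((AddSubgroup.closure_le _).2 fun x hx => ?_)
  · obtain ⟨x, hx, rfl⟩ := Finset.mem_image.1 hy
    have hx' := AddSubgroup.subset_closure (Finset.mem_coe.2 hx)
    rcases hf x with h | h <;> rw [h]
    · exact hx'
    · exact neg_mem hx'
  · have hx' : f x ∈ AddSubgroup.closure ((S.image f : Finset G) : Set G) :=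
      AddSubgroup.subset_closure (Finset.mem_coe.2 (Finset.mem_image_of_mem f hx))
    rcases hf x with h | h <;> rw [h] at hx'
    · exact hx'
    · simpa using neg_mem hx'

end SignChange

/-! ### From an AP-representation to levels. -/

section Progression

variable {G : Type*} [AddCommGroup G] [Fintype G] [DecidableEq G]

lemma card_mul_le_of_forall_mem {H : AddSubgroup G} {g a : G} {n q : ℕ} {X : Set G}
    (hq : ∀ i < q, ∀ j < q, i • g - j • g ∈ H → i = j) (hnq : n ≤ q)
    (hX : ∀ l < n, ∀ x, x - l • g ∈ H → a + x ∈ X) : n * Nat.card H ≤ X.ncard := by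
  classical
  have h1 := sum_card_slice_le hq (Finset.univ.filter fun x => a + x ∈ X)
    (I := Finset.range n) (fun i hi => (Finset.mem_range.1 hi).trans_le hnq)
  rw [Finset.sum_congr rfl (g := fun _ => Nat.card H)] at h1
  · rw [Finset.sum_const, Finset.card_range, smul_eq_mul] at h1
    refine h1.trans ?_
    rw [← Finset.card_image_of_injective _ (add_right_injective a), ← Set.ncard_coe_finset]
    refine Set.ncard_le_ncard (fun y hy => ?_) (Set.toFinite _)
    obtain ⟨x, hx, rfl⟩ := Finset.mem_image.1 (Finset.mem_coe.1 hy)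
    exact (Finset.mem_filter.1 hx).2
  · intro l hl
    rw [← card_slice_univ (g := g) l]
    congr 1
    ext x
    simp only [mem_slice, Finset.mem_filter, Finset.mem_univ, true_and, and_iff_right_iff_imp]
    exact hX l (Finset.mem_range.1 hl) x

/-- A proper arithmetic progression in a cyclic group that is symmetric and contains zero is
centred at zero. -/
lemma eq_two_mul_add_one_of_symm {Q : Type*} [AddCommGroup Q] {X : Set Q} {a d : Q} {n i : ℕ}
    (hX : X = {x | ∃ i : ℕ, i < n ∧ x = a + i • d}) (hn : n < addOrderOf d) (hi : i < n)
    (h0 : a + i • d = 0) (hsymm : ∀ x ∈ X, -x ∈ X) : n = 2 * i + 1 := by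
  have ha : a = -((i : ℤ) • d) := by
    rw [natCast_zsmul]
    exact eq_neg_of_add_eq_zero_left h0
  have hne : ∀ j : ℕ, j < n → ∃ j' : ℕ, j' < n ∧
      (addOrderOf d : ℤ) ∣ ((j : ℤ) + j' - 2 * i) := by
    intro j hj
    have := hsymm (a + j • d) (by rw [hX]; exact ⟨j, hj, rfl⟩)
    rw [hX] at this
    obtain ⟨j', hj', h⟩ := this
    refine ⟨j', hj', addOrderOf_dvd_iff_zsmul_eq_zero.2 ?_⟩
    rw [ha, ← natCast_zsmul, ← natCast_zsmul] at h
    rw [sub_zsmul, add_zsmul, two_mul, add_zsmul]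
    rw [neg_eq_iff_add_eq_zero] at h
    rw [← h]
    abel
  rcases lt_trichotomy n (2 * i + 1) with h | h | h
  -- Negation reflects indices about `i`. This index would reflect to `n`, just past the end, and
  -- the index `2i + 1` below to `-1`; neither is congruent to an index in `0, …, n - 1`, since the
  -- order of `d` exceeds `n`.
  · obtain ⟨j, hj, hd⟩ := hne (2 * i - n) (by omega)
    have := Int.le_of_dvd (by omega) ((dvd_neg).2 hd)
    omega
  · exact h
  · obtain ⟨j, hj, hd⟩ := hne (2 * i + 1) h
    have := Int.le_of_dvd (by omega) hd
    omega

lemma neg_mem_hat {S : Finset G} {x : G} (hx : x ∈ APRep.hat S) : -x ∈ APRep.hat S := by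
  simp only [APRep.hat, Finset.mem_union, Finset.mem_singleton, Finset.mem_neg'] at hx ⊢
  rw [neg_neg, neg_eq_zero]
  tauto

lemma card_hat_le (S : Finset G) : (APRep.hat S).card ≤ 2 * S.card + 1 := by
  have h1 := Finset.card_union_le (S ∪ {0}) (-S)
  have h2 := Finset.card_union_le S {0}
  rw [Finset.card_neg] at h1
  rw [Finset.card_singleton] at h2
  rw [APRep.hat]
  omega

lemma exists_levels_of_isAPRepModulo {S : Finset G} {H : AddSubgroup G}
    (hgen : AddSubgroup.closure (S : Set G) = ⊤) (hH : APRep.IsAPRepModulo (APRep.hat S) H) :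
    ∃ (g : G) (m q : ℕ), (∀ i < q, ∀ j < q, i • g - j • g ∈ H → i = j) ∧ 2 * m + 1 < q ∧
      Nat.card G = q * Nat.card H ∧ m * Nat.card H ≤ S.card ∧
      ∀ x ∈ S, ∃ c : ℕ, c ≤ m ∧ (x - c • g ∈ H ∨ -x - c • g ∈ H) := by
  classical
  obtain ⟨hlt, a, d, n, -, himg⟩ := hH
  rw [lt_min_iff] at hlt
  have hS : S ⊆ APRep.hat S := fun x hx => by simp [APRep.hat, hx]
  have hmk : ∀ x ∈ APRep.hat S, ∃ i < n, (x : G ⧸ H) = a + i • d := by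
    intro x hx
    have : (x : G ⧸ H) ∈ (fun x : G => (x : G ⧸ H)) '' (APRep.hat S : Set G) := ⟨x, hx, rfl⟩
    rw [himg] at this
    exact this
  have hmem : ∀ x : G, ∀ i < n, (x : G ⧸ H) = a + i • d →
      x ∈ (APRep.hat S : Set G) + (H : Set G) := by
    intro x i hi hx
    have : (x : G ⧸ H) ∈ (fun x : G => (x : G ⧸ H)) '' (APRep.hat S : Set G) := by
      rw [himg]; exact ⟨i, hi, hx⟩
    obtain ⟨y, hy, hyx⟩ := this
    exact ⟨y, hy, -y + x, QuotientAddGroup.eq.1 hyx, by simp⟩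
  obtain ⟨i, hi, h0⟩ := hmk 0 (by simp [APRep.hat])
  rw [QuotientAddGroup.mk_zero] at h0
  have ha : a = -(i • d) := eq_neg_of_add_eq_zero_left h0.symm
  obtain ⟨g, rfl⟩ := QuotientAddGroup.mk_surjective d
  obtain ⟨b, hb⟩ := QuotientAddGroup.mk_surjective a
  have hcyc : ∀ y : G ⧸ H, y ∈ AddSubgroup.zmultiples (g : G ⧸ H) := by
    have hle : AddSubgroup.closure (S : Set G) ≤
        (AddSubgroup.zmultiples (g : G ⧸ H)).comap (QuotientAddGroup.mk' H) := by
      refine (AddSubgroup.closure_le _).2 fun x hx => ?_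
      obtain ⟨j, -, hj⟩ := hmk x (hS hx)
      have : (x : G ⧸ H) ∈ AddSubgroup.zmultiples (g : G ⧸ H) := by
        rw [hj, ha]
        exact add_mem (neg_mem (nsmul_mem (AddSubgroup.mem_zmultiples _) _))
          (nsmul_mem (AddSubgroup.mem_zmultiples _) _)
      exact this
    intro y
    obtain ⟨x, rfl⟩ := QuotientAddGroup.mk_surjective y
    exact hle (hgen ▸ AddSubgroup.mem_top x)
  have hcard : addOrderOf (g : G ⧸ H) = Nat.card (G ⧸ H) :=
    addOrderOf_eq_card_of_forall_mem_zmultiples hcyc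
  have hq : ∀ i < addOrderOf (g : G ⧸ H), ∀ j < addOrderOf (g : G ⧸ H),
      i • g - j • g ∈ H → i = j := by
    intro i hi j hj hij
    refine nsmul_injOn_Iio_addOrderOf hi hj ?_
    rw [← (QuotientAddGroup.eq_zero_iff (N := H) _), QuotientAddGroup.mk_sub, sub_eq_zero] at hij
    exact hij
  -- Otherwise the progression is all of `G/H`, against `|Ŝ + H| < |G|`.
  have hnq : n < addOrderOf (g : G ⧸ H) := by
    by_contra hcon
    refine hlt.1.ne ?_
    rw [← Set.ncard_univ]
    congr 1
    refine Set.eq_univ_of_forall fun x => ?_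
    have h1 := hcyc ((x : G ⧸ H) - a)
    rw [mem_zmultiples_iff_mem_range_addOrderOf] at h1
    obtain ⟨j, hj, hjx⟩ := Finset.mem_image.1 h1
    rw [Finset.mem_range] at hj
    refine hmem x j (by omega) ?_
    change j • (g : G ⧸ H) = x - a at hjx
    rw [hjx]
    abel
  have hn := eq_two_mul_add_one_of_symm himg hnq hi h0.symm (by
    rintro _ ⟨x, hx, rfl⟩
    exact ⟨-x, neg_mem_hat hx, rfl⟩)
  have hnH : n * Nat.card H ≤ ((APRep.hat S : Set G) + (H : Set G)).ncard := by
    refine card_mul_le_of_forall_mem (a := b) hq hnq.le fun l hl x hx => hmem _ l hl ?_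
    rw [← (QuotientAddGroup.eq_zero_iff (N := H) _), QuotientAddGroup.mk_sub, sub_eq_zero] at hx
    rw [QuotientAddGroup.mk_add, hb, hx]
    rfl
  refine ⟨g, i, addOrderOf (g : G ⧸ H), hq, hn ▸ hnq, ?_, ?_, fun x hx => ?_⟩
  · rw [hcard]
    exact AddSubgroup.card_eq_card_quotient_mul_card_addSubgroup H
  -- `(2i + 1)|H| ≤ |Ŝ + H| < |H| + |Ŝ| ≤ |H| + 2|S| + 1`, so `i|H| ≤ |S|` by integrality.
  · have h1 := card_hat_le S
    have h2 := hlt.2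
    rw [hn, add_mul, one_mul, mul_assoc] at hnH
    omega
  · obtain ⟨j, hj, hjx⟩ := hmk x (hS hx)
    rw [ha] at hjx
    rcases le_total i j with hij | hij
    · refine ⟨j - i, by omega, Or.inl ?_⟩
      rw [← (QuotientAddGroup.eq_zero_iff (N := H) _), QuotientAddGroup.mk_sub, hjx,
        QuotientAddGroup.mk_nsmul, sub_nsmul _ hij]
      abel
    · refine ⟨i - j, by omega, Or.inr ?_⟩
      rw [← (QuotientAddGroup.eq_zero_iff (N := H) _), QuotientAddGroup.mk_sub,
        QuotientAddGroup.mk_neg, hjx, QuotientAddGroup.mk_nsmul, sub_nsmul _ hij]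
      abel

end Progression

/-! ### Conclusion: moving `S` to non-negative levels by sign changes. -/

theorem mainTheorem4 {G : Type*} [AddCommGroup G] [Fintype G] [DecidableEq G]
    (S : Finset G)
    (hgen : AddSubgroup.closure (S : Set G) = ⊤)
    (hdisj : S ∩ (-S) = ∅)
    (hcard : 4 ≤ S.card)
    (hAP : APRep.HasAPRepresentation (APRep.hat S)) :
    ((S.card : ℚ) * ((S.card : ℚ) + 1) / 2 + 1 ≤ (S.subsetSum.card : ℚ)) ∨
    (∃ S' : Finset G, S' ⊆ S ∧ S'.Nonempty ∧
      (Nat.card (AddSubgroup.closure (S' : Set G)) : ℚ) / 2 <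
        (S'.subsetSum.card : ℚ)) := by
  classical
  by_cases hii : ∃ S' : Finset G, S' ⊆ S ∧ S'.Nonempty ∧
      (Nat.card (AddSubgroup.closure (S' : Set G)) : ℚ) / 2 < (S'.subsetSum.card : ℚ)
  · exact Or.inr hii
  left
  have hhalf : ∀ S' ⊆ S, S'.Nonempty →
      2 * S'.subsetSum.card ≤ Nat.card (AddSubgroup.closure (S' : Set G)) := by
    intro S' hS' hne
    by_contra hcon
    refine hii ⟨S', hS', hne, ?_⟩
    have : (Nat.card (AddSubgroup.closure (S' : Set G)) : ℚ) < 2 * S'.subsetSum.card := by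
      exact_mod_cast not_le.1 hcon
    linarith
  have hS : ∀ x ∈ S, -x ∉ S := by
    intro x hx hx'
    have : x ∈ S ∩ (-S) := Finset.mem_inter.2 ⟨hx, Finset.mem_neg'.2 hx'⟩
    simp [hdisj] at this
  obtain ⟨H, hH⟩ := hAP
  obtain ⟨g, m, q, hq, hmq, hG, hmS, hlevel⟩ := exists_levels_of_isAPRepModulo hgen hH
  have hHpos : 0 < Nat.card H := Nat.card_pos
  set f : G → G := fun x => if ∃ c : ℕ, c ≤ m ∧ x - c • g ∈ H then x else -x with hfdef
  have hf : ∀ x, f x = x ∨ f x = -x := by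
    intro x
    by_cases h : ∃ c : ℕ, c ≤ m ∧ x - c • g ∈ H
    · exact Or.inl (if_pos h)
    · exact Or.inr (if_neg h)
  have hfl : ∀ y ∈ S.image f, ∃ c : ℕ, c ≤ m ∧ y - c • g ∈ H := by
    intro y hy
    obtain ⟨x, hx, rfl⟩ := Finset.mem_image.1 hy
    by_cases h : ∃ c : ℕ, c ≤ m ∧ x - c • g ∈ H
    · rw [hfdef]
      simpa only [if_pos h] using h
    · obtain ⟨c, hc, h' | h'⟩ := hlevel x hx
      · exact absurd ⟨c, hc, h'⟩ h
      · rw [hfdef]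
        simp only [if_neg h]
        exact ⟨c, hc, h'⟩
  choose! lev hm hlev using hfl
  have hTcard : (S.image f).card = S.card := Finset.card_image_of_injOn (injOn_of_sign hS hf)
  have hTgen := (closure_image_sign (S := S) hf).trans hgen
  -- If `m = 0`, then `H` contains a generating set, so `H = G` and `q = 1`.
  have hm1 : 1 ≤ m := by
    by_contra hm0
    have hle : AddSubgroup.closure ((S.image f : Finset G) : Set G) ≤ H := by
      refine (AddSubgroup.closure_le _).2 fun x hx => ?_
      have h1 := hm x hx
      have h2 := hlev x hx
      rw [show lev x = 0 by omega] at h2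
      simpa using h2
    rw [hTgen, top_le_iff] at hle
    rw [hle, AddSubgroup.card_top] at hG
    have : 0 < Nat.card G := Nat.card_pos
    nlinarith
  have hmain := card_subsetSum_ge_of_levels (T := S.image f) hq (by omega) hG ?_
    (by omega) hm hm1 hlev (by omega) hTgen ?_
  · have hle := card_subsetSum_image_sign_le hS hf
    rw [hTcard] at hmain
    have h1 : S.card * (S.card + 1) + 2 ≤ 2 * S.subsetSum.card := by omega
    have h2 : (S.card : ℚ) * (S.card + 1) + 2 ≤ 2 * S.subsetSum.card := by exact_mod_cast h1
    linarith
  · intro y hy hy'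
    obtain ⟨x, hx, rfl⟩ := Finset.mem_image.1 hy
    obtain ⟨z, hz, hzx⟩ := Finset.mem_image.1 hy'
    have hxz : z = x ∨ z = -x := by
      rcases hf x with h | h <;> rcases hf z with h' | h' <;> rw [h, h'] at hzx
      · exact Or.inr hzx
      · exact Or.inl (neg_injective hzx)
      · exact Or.inl (by simpa using hzx)
      · exact Or.inr (neg_injective hzx)
    rcases hxz with rfl | rfl
    · have : z = -z := by
        rcases hf z with h | h <;> rw [h] at hzx
        · exact hzx
        · simpa using hzx.symm
      exact hS z hz (this ▸ hz)
    · exact hS x hx hz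
  · intro T' hT' hne
    obtain ⟨S', hS', rfl⟩ := Finset.subset_image_iff.1 hT'
    have hS'' : S' ⊆ S := hS'
    have h1 := card_subsetSum_image_sign_le
      (fun x hx hx' => hS x (hS'' hx) (hS'' hx')) hf (S := S')
    have h2 := hhalf S' hS'' (Finset.image_nonempty.1 hne)
    rw [closure_image_sign hf]
    omega
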